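/- Let $L>0$, let $\mathbb K\in\{\mathbb R,\mathbb C\}$, let $X=L_2(0,L)$ be the space of $\mathbb K$-valued square-integrable functions on $(0,L)$, and let $c\in X$. Let $H^k(0,L)$ be the space of all $f\in X$ whose weak derivatives of every order $\le k$ exist and belong to $X$, with norm $\|f\|_{H^k}=\big(\sum_{j\le k}\|f^{(j)}\|_{L_2}^2\big)^{1/2}$, and let $H^1_0(0,L)$ be the closure in the norm of $H^1(0,L)$ of the set of continuously differentiable functions with compact support in $(0,L)$. Consider the operator $$A f=\partial_{xx}f+c(\cdot)f,\qquad D(A)=H^2(0,L)\cap H^1_0(0,L)\subset X .$$ Then $A$ is well defined as a linear operator $D(A)\to X$ and has a compact resolvent. That is, $A$ is closed and densely defined, and there is $\lambda\in\rho(A)$ (i.e. $\lambda\in\mathbb K$ such that $\lambda-A:D(A)\to X$ is bijective with bounded inverse) for which the resolvent $R_\lambda(A)=(\lambda-A)^{-1}:X\to X$ is a compact operator. -/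

import Mathlib

open MeasureTheory Set Filter Topology
open scoped ContDiff ENNReal

namespace LinearPMap

variable {𝕜 E : Type*} [NontriviallyNormedField 𝕜] [NormedAddCommGroup E] [NormedSpace 𝕜 E]

/-- The bounded operator `R` is the resolvent `(z - A)⁻¹` of the unbounded operator `A` at `z`:
it is a two-sided inverse of `z - A : D(A) → E`. -/
def IsResolventAt (A : E →ₗ.[𝕜] E) (z : 𝕜) (R : E →L[𝕜] E) : Prop :=
  (∀ x : E, ∃ h : R x ∈ A.domain, z • R x - A ⟨R x, h⟩ = x) ∧
    ∀ y : A.domain, R (z • (y : E) - A y) = y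

/-- The resolvent set of `A`: all `z` such that `z - A : D(A) → E` is bijective with bounded
inverse. -/
def unboundedResolventSet (A : E →ₗ.[𝕜] E) : Set 𝕜 :=
  {z | ∃ R : E →L[𝕜] E, A.IsResolventAt z R}

/-- The resolvent of `A` at a point of the resolvent set. -/
noncomputable def unboundedResolvent (A : E →ₗ.[𝕜] E) (z : A.unboundedResolventSet) : E →L[𝕜] E :=
  z.2.choose

/-- An unbounded operator has a compact resolvent if it is closed and densely defined, and
its resolvent is a compact operator for some point of the resolvent set. -/
def HasCompactResolvent (A : E →ₗ.[𝕜] E) : Prop :=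
  A.IsClosed ∧ Dense (A.domain : Set E) ∧
    ∃ z : A.unboundedResolventSet, IsCompactOperator (A.unboundedResolvent z)

/-- The resolvent at a given point is unique. -/
theorem IsResolventAt.unique {A : E →ₗ.[𝕜] E} {z : 𝕜} {R S : E →L[𝕜] E}
    (hR : A.IsResolventAt z R) (hS : A.IsResolventAt z S) : R = S := by
  ext x
  obtain ⟨h, hx⟩ := hR.1 x
  have := hS.2 ⟨R x, h⟩
  rw [hx] at this
  exact this.symm

theorem unboundedResolvent_spec (A : E →ₗ.[𝕜] E) (z : A.unboundedResolventSet) :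
    A.IsResolventAt z (A.unboundedResolvent z) :=
  z.2.choose_spec

end LinearPMap

namespace SturmLiouville

variable (𝕜 : Type*) [RCLike 𝕜] (L : ℝ)

/-- The Lebesgue measure on the interval `(0, L)`. -/
noncomputable abbrev intervalMeasure : Measure ℝ := volume.restrict (Ioo 0 L)

/-- The space `L₂(0, L)` with values in `𝕜`. -/
abbrev L2 : Type _ := Lp 𝕜 2 (intervalMeasure L)

variable {𝕜 L}

/-- Test functions on `(0, L)`: smooth with compact support contained in `(0, L)`. -/
def IsTestFunction (L : ℝ) (η : ℝ → ℝ) : Prop :=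
  ContDiff ℝ ∞ η ∧ HasCompactSupport η ∧ tsupport η ⊆ Ioo 0 L

/-- `g` is a weak derivative of order `k` of `f` on `(0, L)`. -/
def IsWeakDeriv (k : ℕ) (f g : L2 𝕜 L) : Prop :=
  ∀ η : ℝ → ℝ, IsTestFunction L η →
    ∫ x in Ioo 0 L, iteratedDeriv k η x • f x = (-1 : ℝ) ^ k • ∫ x in Ioo 0 L, η x • g x

theorem memLp_of_continuous_of_hasCompactSupport {F : Type*} [NormedAddCommGroup F] {η : ℝ → F}
    (hc : Continuous η) (hs : HasCompactSupport η) (p : ℝ≥0∞) :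
    MemLp η p (intervalMeasure L) :=
  (hc.memLp_of_hasCompactSupport hs (μ := volume)).restrict _

theorem integrable_smul_L2 {η : ℝ → ℝ} (hc : Continuous η) (hs : HasCompactSupport η)
    (f : L2 𝕜 L) : Integrable (fun x => η x • f x) (intervalMeasure L) := by
  have h := (Lp.memLp f).smul (r := 1)
    (memLp_of_continuous_of_hasCompactSupport (L := L) hc hs 2)
  exact memLp_one_iff_integrable.1 h

theorem IsTestFunction.continuous_iteratedDeriv {η : ℝ → ℝ} (h : IsTestFunction L η) (k : ℕ) :
    Continuous (iteratedDeriv k η) :=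
  h.1.continuous_iteratedDeriv k (by exact_mod_cast le_top)

theorem IsTestFunction.hasCompactSupport_iteratedDeriv {η : ℝ → ℝ} (h : IsTestFunction L η)
    (k : ℕ) : HasCompactSupport (iteratedDeriv k η) := by
  induction k with
  | zero => simpa using h.2.1
  | succ k ih => rw [iteratedDeriv_succ]; exact ih.deriv

variable (𝕜 L) in
/-- The graph of the weak derivative of order `k` in `L₂(0, L)`. -/
def weakDerivGraph (k : ℕ) : Submodule 𝕜 (L2 𝕜 L × L2 𝕜 L) where
  carrier := {p | IsWeakDeriv k p.1 p.2}
  zero_mem' := by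
    intro η hη
    have h : ∀ᵐ x ∂intervalMeasure L, (0 : L2 𝕜 L) x = 0 := Lp.coeFn_zero _ _ _
    rw [integral_eq_zero_of_ae, integral_eq_zero_of_ae, smul_zero]
    · filter_upwards [h] with x hx
      exact (congrArg _ hx).trans (smul_zero _)
    · filter_upwards [h] with x hx
      exact (congrArg _ hx).trans (smul_zero _)
  add_mem' := by
    rintro ⟨f, g⟩ ⟨f', g'⟩ h h' η hη
    have e1 : ∫ x in Ioo 0 L, iteratedDeriv k η x • (f + f') x
        = ∫ x in Ioo 0 L, (iteratedDeriv k η x • f x + iteratedDeriv k η x • f' x) := by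
      apply integral_congr_ae
      filter_upwards [Lp.coeFn_add f f'] with x hx
      rw [hx, Pi.add_apply, smul_add]
    have e2 : ∫ x in Ioo 0 L, η x • (g + g') x
        = ∫ x in Ioo 0 L, (η x • g x + η x • g' x) := by
      apply integral_congr_ae
      filter_upwards [Lp.coeFn_add g g'] with x hx
      rw [hx, Pi.add_apply, smul_add]
    have c1 := hη.continuous_iteratedDeriv k
    have s1 := hη.hasCompactSupport_iteratedDeriv k
    change ∫ x in Ioo 0 L, iteratedDeriv k η x • (f + f') x
      = (-1 : ℝ) ^ k • ∫ x in Ioo 0 L, η x • (g + g') x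
    rw [e1, e2, integral_add (integrable_smul_L2 c1 s1 f) (integrable_smul_L2 c1 s1 f'),
      integral_add (integrable_smul_L2 hη.1.continuous hη.2.1 g)
        (integrable_smul_L2 hη.1.continuous hη.2.1 g'), smul_add]
    exact congrArg₂ _ (h η hη) (h' η hη)
  smul_mem' := by
    rintro a ⟨f, g⟩ h η hη
    have e1 : ∫ x in Ioo 0 L, iteratedDeriv k η x • (a • f) x
        = ∫ x in Ioo 0 L, a • (iteratedDeriv k η x • f x) := by
      apply integral_congr_ae
      filter_upwards [Lp.coeFn_smul a f] with x hx
      rw [hx, Pi.smul_apply, smul_comm]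
    have e2 : ∫ x in Ioo 0 L, η x • (a • g) x = ∫ x in Ioo 0 L, a • (η x • g x) := by
      apply integral_congr_ae
      filter_upwards [Lp.coeFn_smul a g] with x hx
      rw [hx, Pi.smul_apply, smul_comm]
    change ∫ x in Ioo 0 L, iteratedDeriv k η x • (a • f) x
      = (-1 : ℝ) ^ k • ∫ x in Ioo 0 L, η x • (a • g) x
    rw [e1, e2, integral_smul, integral_smul, smul_comm ((-1 : ℝ) ^ k)]
    exact congrArg _ (h η hη)

/-- Weak derivatives are unique. -/
theorem weakDerivGraph_functional (k : ℕ) (p : L2 𝕜 L × L2 𝕜 L) (hp : p ∈ weakDerivGraph 𝕜 L k)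
    (h0 : p.1 = 0) : p.2 = 0 := by
  have hp' : IsWeakDeriv k p.1 p.2 := hp
  have hint : Integrable p.2 (intervalMeasure L) := (Lp.memLp p.2).integrable one_le_two
  have key : ∀ᵐ x : ℝ, x ∈ Ioo 0 L → p.2 x = 0 := by
    refine isOpen_Ioo.ae_eq_zero_of_integral_contDiff_smul_eq_zero
      (IntegrableOn.locallyIntegrableOn hint) fun η h1 h2 h3 => ?_
    have h := hp' η ⟨h1, h2, h3⟩
    have hz : ∫ x in Ioo 0 L, iteratedDeriv k η x • p.1 x = 0 := by
      apply integral_eq_zero_of_ae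
      rw [h0]
      filter_upwards [Lp.coeFn_zero 𝕜 2 (intervalMeasure L)] with x hx
      exact (congrArg _ hx).trans (smul_zero _)
    rw [hz] at h
    have h' := (smul_eq_zero.1 h.symm).resolve_left (by simp)
    rw [← h', eq_comm]
    apply setIntegral_eq_integral_of_forall_compl_eq_zero
    intro x hx
    rw [image_eq_zero_of_notMem_tsupport (fun hx' => hx (h3 hx')), zero_smul]
  apply Lp.ext
  filter_upwards [(ae_restrict_iff' measurableSet_Ioo).2 key,
    Lp.coeFn_zero 𝕜 2 (intervalMeasure L)] with x hx hx0
  rw [hx, hx0, Pi.zero_apply]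

variable (𝕜 L) in
/-- The weak derivative of order `k` as an operator in `L₂(0, L)` whose domain consists of
all functions that have a weak derivative of order `k` in `L₂(0, L)`. -/
noncomputable def weakDeriv (k : ℕ) : L2 𝕜 L →ₗ.[𝕜] L2 𝕜 L :=
  (weakDerivGraph 𝕜 L k).toLinearPMap

theorem mem_weakDeriv_domain_iff {k : ℕ} {f : L2 𝕜 L} :
    f ∈ (weakDeriv 𝕜 L k).domain ↔ ∃ g, IsWeakDeriv k f g := by
  rw [weakDeriv, Submodule.toLinearPMap_domain]
  exact ⟨fun ⟨p, hp, e⟩ => ⟨p.2, e ▸ hp⟩, fun ⟨g, hg⟩ => ⟨(f, g), hg, rfl⟩⟩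

theorem isWeakDeriv_weakDeriv {k : ℕ} (f : (weakDeriv 𝕜 L k).domain) :
    IsWeakDeriv k (f : L2 𝕜 L) (weakDeriv 𝕜 L k f) :=
  Submodule.mem_graph_toLinearPMap (weakDerivGraph_functional k) f

theorem weakDeriv_eq_of_isWeakDeriv {k : ℕ} (f : (weakDeriv 𝕜 L k).domain) {g : L2 𝕜 L}
    (h : IsWeakDeriv k (f : L2 𝕜 L) g) : weakDeriv 𝕜 L k f = g := by
  have := weakDerivGraph_functional k _ ((weakDerivGraph 𝕜 L k).sub_mem
    (show ((f : L2 𝕜 L), weakDeriv 𝕜 L k f) ∈ _ from isWeakDeriv_weakDeriv f)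
    (show ((f : L2 𝕜 L), g) ∈ _ from h)) (by simp)
  exact sub_eq_zero.1 this

variable (𝕜 L) in
/-- The Sobolev space `Hᵏ(0, L)`: all `f ∈ L₂(0, L)` with weak derivatives of every order `≤ k`
in `L₂(0, L)`. -/
noncomputable def sobolevH (k : ℕ) : Submodule 𝕜 (L2 𝕜 L) :=
  ⨅ j : Fin (k + 1), (weakDeriv 𝕜 L j).domain

theorem mem_sobolevH_iff {k : ℕ} {f : L2 𝕜 L} :
    f ∈ sobolevH 𝕜 L k ↔ ∀ j ≤ k, ∃ g, IsWeakDeriv j f g := by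
  simp only [sobolevH, Submodule.mem_iInf, mem_weakDeriv_domain_iff]
  exact ⟨fun h j hj => h ⟨j, by omega⟩, fun h j => h j (by omega)⟩

theorem sobolevH_le_domain {j k : ℕ} (h : j ≤ k) : sobolevH 𝕜 L k ≤ (weakDeriv 𝕜 L j).domain :=
  fun _ hf => mem_weakDeriv_domain_iff.2 (mem_sobolevH_iff.1 hf j h)

variable (𝕜 L) in
/-- The map `f ↦ (f, f', …, f⁽ᵏ⁾)` on `Hᵏ(0, L)` into the Hilbert sum of `k + 1` copies of
`L₂(0, L)`. The norm of `Hᵏ(0, L)` is `‖sobolevJet f‖ = (∑_{j ≤ k} ‖f⁽ʲ⁾‖²)^(1/2)`. -/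
noncomputable def sobolevJet (k : ℕ) :
    sobolevH 𝕜 L k →ₗ[𝕜] PiLp 2 (fun _ : Fin (k + 1) => L2 𝕜 L) :=
  (WithLp.linearEquiv 2 𝕜 (Fin (k + 1) → L2 𝕜 L)).symm.toLinearMap ∘ₗ
    LinearMap.pi fun j : Fin (k + 1) =>
      (weakDeriv 𝕜 L j).toFun ∘ₗ Submodule.inclusion (sobolevH_le_domain (Nat.lt_succ_iff.1 j.2))

variable (𝕜 L) in
/-- The elements of `Hᵏ(0, L)` represented by functions in `C₀ᵏ(0, L)`, i.e. `k` times continuously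
differentiable functions with compact support in `(0, L)`. -/
def testC0 (k : ℕ) : Set (sobolevH 𝕜 L k) :=
  {f | ∃ ψ : ℝ → 𝕜, ContDiff ℝ k ψ ∧ HasCompactSupport ψ ∧ tsupport ψ ⊆ Ioo 0 L ∧
    (f : L2 𝕜 L) =ᵐ[intervalMeasure L] ψ}

variable (𝕜 L) in
/-- The norm of `Hᵏ(0, L)`. -/
noncomputable def sobolevNorm (k : ℕ) (f : sobolevH 𝕜 L k) : ℝ := ‖sobolevJet 𝕜 L k f‖

theorem sobolevNorm_eq (k : ℕ) (f : sobolevH 𝕜 L k) :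
    sobolevNorm 𝕜 L k f = √(∑ j : Fin (k + 1),
      ‖weakDeriv 𝕜 L j ⟨f, sobolevH_le_domain (Nat.lt_succ_iff.1 j.2) f.2⟩‖ ^ 2) := by
  rw [sobolevNorm, PiLp.norm_eq_of_L2]
  rfl

theorem sobolevNorm_add_le (k : ℕ) (f g : sobolevH 𝕜 L k) :
    sobolevNorm 𝕜 L k (f + g) ≤ sobolevNorm 𝕜 L k f + sobolevNorm 𝕜 L k g := by
  simp only [sobolevNorm, map_add]
  exact norm_add_le _ _

theorem sobolevNorm_smul (k : ℕ) (a : 𝕜) (f : sobolevH 𝕜 L k) :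
    sobolevNorm 𝕜 L k (a • f) = ‖a‖ * sobolevNorm 𝕜 L k f := by
  simp only [sobolevNorm, map_smul, norm_smul]

variable (𝕜 L) in
/-- The space `H₀ᵏ(0, L)`: the closure of `C₀ᵏ(0, L)` in the norm of `Hᵏ(0, L)`. -/
noncomputable def sobolevH0 (k : ℕ) : Submodule 𝕜 (L2 𝕜 L) where
  carrier := {f | ∃ hf : f ∈ sobolevH 𝕜 L k, ∀ ε : ℝ, 0 < ε →
    ∃ φ ∈ testC0 𝕜 L k, sobolevNorm 𝕜 L k (⟨f, hf⟩ - φ) < ε}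
  zero_mem' := by
    refine ⟨zero_mem _, fun ε hε => ⟨0, ⟨fun _ => 0, contDiff_const, HasCompactSupport.zero, ?_,
      Lp.coeFn_zero _ _ _⟩, ?_⟩⟩
    · exact (tsupport_eq_empty_iff.2 rfl : tsupport (fun _ : ℝ => (0 : 𝕜)) = ∅) ▸ empty_subset _
    · have : (⟨0, zero_mem _⟩ : sobolevH 𝕜 L k) - 0 = 0 := by simp
      rw [this, sobolevNorm, map_zero, norm_zero]
      exact hε
  add_mem' := by
    rintro f g ⟨hf, h⟩ ⟨hg, h'⟩
    refine ⟨add_mem hf hg, fun ε hε => ?_⟩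
    obtain ⟨φ, ⟨u, u1, u2, u3, u4⟩, h1⟩ := h (ε / 2) (half_pos hε)
    obtain ⟨φ', ⟨v, v1, v2, v3, v4⟩, h2⟩ := h' (ε / 2) (half_pos hε)
    refine ⟨φ + φ', ⟨u + v, u1.add v1, u2.add v2,
      (tsupport_add u v).trans (union_subset u3 v3), ?_⟩, ?_⟩
    · exact (Lp.coeFn_add _ _).trans (u4.add v4)
    · have e : (⟨f + g, add_mem hf hg⟩ : sobolevH 𝕜 L k) - (φ + φ')
          = (⟨f, hf⟩ - φ) + (⟨g, hg⟩ - φ') := by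
        exact add_sub_add_comm (⟨f, hf⟩ : sobolevH 𝕜 L k) ⟨g, hg⟩ φ φ'
      rw [e]
      exact (sobolevNorm_add_le k _ _).trans_lt (by linarith)
  smul_mem' := by
    rintro a f ⟨hf, h⟩
    refine ⟨Submodule.smul_mem _ a hf, fun ε hε => ?_⟩
    have ha : 0 < ‖a‖ + 1 := by positivity
    obtain ⟨φ, ⟨u, u1, u2, u3, u4⟩, h1⟩ := h (ε / (‖a‖ + 1)) (div_pos hε ha)
    refine ⟨a • φ, ⟨fun x => a • u x, u1.const_smul a, u2.mono ?_, ?_, ?_⟩, ?_⟩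
    · exact Function.support_const_smul_subset a u
    · exact (closure_mono (Function.support_const_smul_subset a u)).trans u3
    · exact (Lp.coeFn_smul _ _).trans (u4.const_smul a)
    · have e : (⟨a • f, Submodule.smul_mem _ a hf⟩ : sobolevH 𝕜 L k) - a • φ
          = a • (⟨f, hf⟩ - φ) := by
        rw [smul_sub]; rfl
      rw [e, sobolevNorm_smul]
      have h0 : 0 ≤ sobolevNorm 𝕜 L k (⟨f, hf⟩ - φ) := norm_nonneg _
      rw [lt_div_iff₀ ha] at h1
      nlinarith [norm_nonneg a]

/-- A `C¹` function with compact support in `(0, L)` has its classical derivative as weak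
derivative. -/
theorem isWeakDeriv_one_of_contDiff {ψ : ℝ → 𝕜} (h1 : ContDiff ℝ 1 ψ)
    {f g : L2 𝕜 L} (hs : HasCompactSupport ψ) (hL : tsupport ψ ⊆ Ioo 0 L)
    (hf : f =ᵐ[intervalMeasure L] ψ) (hg : g =ᵐ[intervalMeasure L] deriv ψ) :
    IsWeakDeriv 1 f g := by
  intro η hη
  have hψ' : Continuous (deriv ψ) := h1.continuous_deriv le_rfl
  have hη' : Continuous (deriv η) := hη.1.continuous_deriv (by simp)
  have e1 : ∫ x in Ioo 0 L, iteratedDeriv 1 η x • f x = ∫ x, deriv η x • ψ x := by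
    rw [← setIntegral_eq_integral_of_forall_compl_eq_zero (s := Ioo 0 L)
      (f := fun x => deriv η x • ψ x)]
    · apply integral_congr_ae
      filter_upwards [hf] with x hx
      rw [hx, iteratedDeriv_one]
    · intro x hx
      rw [image_eq_zero_of_notMem_tsupport (fun h => hx (hL h)), smul_zero]
  have e2 : ∫ x in Ioo 0 L, η x • g x = ∫ x, η x • deriv ψ x := by
    rw [← setIntegral_eq_integral_of_forall_compl_eq_zero (s := Ioo 0 L)
      (f := fun x => η x • deriv ψ x)]
    · apply integral_congr_ae
      filter_upwards [hg] with x hx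
      rw [hx]
    · intro x hx
      rw [image_eq_zero_of_notMem_tsupport (fun h => hx (hη.2.2 h)), zero_smul]
  have i1 : Integrable fun x => η x • deriv ψ x :=
    (hη.1.continuous.smul hψ').integrable_of_hasCompactSupport hη.2.1.smul_right
  have i2 : Integrable fun x => deriv η x • ψ x :=
    (hη'.smul h1.continuous).integrable_of_hasCompactSupport hs.smul_left
  have i3 : Integrable fun x => η x • ψ x :=
    (hη.1.continuous.smul h1.continuous).integrable_of_hasCompactSupport hs.smul_left
  have hd : ∀ x, HasDerivAt (fun x => η x • ψ x) (η x • deriv ψ x + deriv η x • ψ x) x :=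
    fun x => ((hη.1.differentiable (by simp)) x).hasDerivAt.smul
      ((h1.differentiable one_ne_zero) x).hasDerivAt
  have := integral_eq_zero_of_hasDerivAt_of_integrable hd (i1.add i2) i3
  rw [integral_add i1 i2] at this
  rw [e1, e2, pow_one, neg_one_smul]
  exact eq_neg_of_add_eq_zero_right this

/-- Elements of `H₀¹(0, L)` are essentially bounded. -/
theorem exists_bound_of_mem_sobolevH0 {f : L2 𝕜 L} (hf : f ∈ sobolevH0 𝕜 L 1) :
    ∃ C : ℝ, ∀ᵐ x ∂intervalMeasure L, ‖f x‖ ≤ C := by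
  obtain ⟨hf1, happ⟩ := hf
  choose φ hφ hlt using fun n : ℕ => happ (1 / ((n : ℝ) + 1)) (by positivity)
  set K : ℝ := ((intervalMeasure L univ) ^ (1 / 2 : ℝ)).toReal with hK
  have hKfin : (intervalMeasure L univ) ^ (1 / 2 : ℝ) ≠ ⊤ :=
    ENNReal.rpow_ne_top_of_nonneg (by norm_num) (measure_ne_top (intervalMeasure L) univ)
  -- the bound for functions in the dense class
  have hbd : ∀ u ∈ testC0 𝕜 L 1, ∀ᵐ x ∂intervalMeasure L,
      ‖(u : L2 𝕜 L) x‖ ≤ K * sobolevNorm 𝕜 L 1 u := by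
    rintro u ⟨ψ, p1, p2, p3, p4⟩
    have p1' : ContDiff ℝ 1 ψ := by exact_mod_cast p1
    have c' : Continuous (deriv ψ) := p1'.continuous_deriv le_rfl
    have m2 : MemLp (deriv ψ) 2 (intervalMeasure L) :=
      memLp_of_continuous_of_hasCompactSupport c' p2.deriv 2
    have hw : IsWeakDeriv 1 (u : L2 𝕜 L) (m2.toLp _) :=
      isWeakDeriv_one_of_contDiff p1' p2 p3 p4 m2.coeFn_toLp
    have hn : ‖m2.toLp (deriv ψ)‖ ≤ sobolevNorm 𝕜 L 1 u := by
      have h := PiLp.norm_apply_le (sobolevJet 𝕜 L 1 u) 1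
      have e : sobolevJet 𝕜 L 1 u 1 = m2.toLp (deriv ψ) :=
        weakDeriv_eq_of_isWeakDeriv (k := 1)
          ⟨(u : L2 𝕜 L), sobolevH_le_domain (j := 1) le_rfl u.2⟩ hw
      rwa [e] at h
    have hint : ∫ x in Ioo 0 L, ‖deriv ψ x‖ ≤ K * ‖m2.toLp (deriv ψ)‖ := by
      have i := eLpNorm_le_eLpNorm_mul_rpow_measure_univ (one_le_two : (1 : ℝ≥0∞) ≤ 2)
        m2.aestronglyMeasurable
      rw [integral_norm_eq_lintegral_enorm m2.aestronglyMeasurable, ← eLpNorm_one_eq_lintegral_enorm,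
        Lp.norm_toLp, mul_comm, hK, ← ENNReal.toReal_mul]
      refine ENNReal.toReal_mono (ENNReal.mul_ne_top m2.2.ne hKfin) (i.trans_eq ?_)
      norm_num
    filter_upwards [p4, ae_restrict_mem measurableSet_Ioo] with x hx hxL
    have h0 : ψ 0 = 0 := image_eq_zero_of_notMem_tsupport fun h => lt_irrefl _ (p3 h).1
    have ftc : ∫ t in (0 : ℝ)..x, deriv ψ t = ψ x := by
      rw [intervalIntegral.integral_deriv_eq_sub
        (fun t _ => (p1'.differentiable one_ne_zero) t) (c'.intervalIntegrable _ _), h0, sub_zero]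
    calc ‖(u : L2 𝕜 L) x‖ = ‖∫ t in (0 : ℝ)..x, deriv ψ t‖ := by rw [hx, ftc]
      _ ≤ ∫ t in Ioc 0 x, ‖deriv ψ t‖ := by
        rw [intervalIntegral.integral_of_le hxL.1.le]
        exact norm_integral_le_integral_norm _
      _ ≤ ∫ t in Ioo 0 L, ‖deriv ψ t‖ :=
        setIntegral_mono_set (m2.integrable one_le_two).norm
          (ae_of_all _ fun _ => norm_nonneg _)
          (LE.le.eventuallyLE fun t ht => ⟨ht.1, ht.2.trans_lt hxL.2⟩)
      _ ≤ K * ‖m2.toLp (deriv ψ)‖ := hint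
      _ ≤ K * sobolevNorm 𝕜 L 1 u := mul_le_mul_of_nonneg_left hn ENNReal.toReal_nonneg
  have hle : ∀ n : ℕ, 1 / ((n : ℝ) + 1) ≤ 1 := fun n => by
    rw [div_le_one (by positivity)]; linarith [Nat.cast_nonneg (α := ℝ) n]
  have hφb : ∀ n, sobolevNorm 𝕜 L 1 (φ n) ≤ sobolevNorm 𝕜 L 1 ⟨f, hf1⟩ + 1 := fun n => by
    have e : sobolevNorm 𝕜 L 1 (φ n) ≤ sobolevNorm 𝕜 L 1 ⟨f, hf1⟩
        + sobolevNorm 𝕜 L 1 (⟨f, hf1⟩ - φ n) := by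
      simp only [sobolevNorm, map_sub]
      exact norm_le_norm_add_norm_sub _ _
    linarith [hlt n, hle n]
  have hconv : Tendsto (fun n => (φ n : L2 𝕜 L)) atTop (𝓝 f) := by
    rw [tendsto_iff_norm_sub_tendsto_zero]
    refine squeeze_zero (fun _ => norm_nonneg _) (fun n => ?_)
      tendsto_one_div_add_atTop_nhds_zero_nat
    refine le_trans ?_ (hlt n).le
    have h := PiLp.norm_apply_le (sobolevJet 𝕜 L 1 (⟨f, hf1⟩ - φ n)) 0
    have e : sobolevJet 𝕜 L 1 (⟨f, hf1⟩ - φ n) 0 = f - φ n := by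
      refine weakDeriv_eq_of_isWeakDeriv (k := 0)
        ⟨_, sobolevH_le_domain (j := 0) zero_le_one (⟨f, hf1⟩ - φ n : sobolevH 𝕜 L 1).2⟩ ?_
      intro η _
      simp
    rw [e] at h
    rw [norm_sub_rev]
    exact h
  obtain ⟨ns, -, hns⟩ := (tendstoInMeasure_of_tendsto_Lp hconv).exists_seq_tendsto_ae
  refine ⟨K * (sobolevNorm 𝕜 L 1 ⟨f, hf1⟩ + 1), ?_⟩
  filter_upwards [hns, ae_all_iff.2 fun n => hbd (φ n) (hφ n)] with x hx hb
  refine le_of_tendsto hx.norm (Eventually.of_forall fun n => (hb (ns n)).trans ?_)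
  exact mul_le_mul_of_nonneg_left (hφb _) ENNReal.toReal_nonneg

/-- The product of a function in `L₂(0, L)` and a function in `H₀¹(0, L)` is in `L₂(0, L)`. -/
theorem memLp_mul_of_mem_sobolevH0 (c : L2 𝕜 L) {f : L2 𝕜 L} (hf : f ∈ sobolevH0 𝕜 L 1) :
    MemLp (fun x => c x * f x) 2 (intervalMeasure L) := by
  obtain ⟨C, hC⟩ := exists_bound_of_mem_sobolevH0 hf
  refine (Lp.memLp c).of_le_mul (c := C)
    ((Lp.aestronglyMeasurable c).mul (Lp.aestronglyMeasurable f)) ?_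
  filter_upwards [hC] with x hx
  rw [norm_mul, mul_comm]
  exact mul_le_mul_of_nonneg_right hx (norm_nonneg _)

/-- The operator `A = ∂ₓₓ + c(·)` in `L₂(0, L)` with domain `H²(0, L) ∩ H₀¹(0, L)`. -/
noncomputable def operatorA (c : L2 𝕜 L) : L2 𝕜 L →ₗ.[𝕜] L2 𝕜 L where
  domain := sobolevH 𝕜 L 2 ⊓ sobolevH0 𝕜 L 1
  toFun :=
    { toFun := fun f => weakDeriv 𝕜 L 2 ⟨f, sobolevH_le_domain le_rfl f.2.1⟩
        + (memLp_mul_of_mem_sobolevH0 c f.2.2).toLp (fun x => c x * (f : L2 𝕜 L) x)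
      map_add' := by
        intro f g
        have e1 : weakDeriv 𝕜 L 2 ⟨_, sobolevH_le_domain le_rfl (f + g).2.1⟩
            = weakDeriv 𝕜 L 2 ⟨f, sobolevH_le_domain le_rfl f.2.1⟩
              + weakDeriv 𝕜 L 2 ⟨g, sobolevH_le_domain le_rfl g.2.1⟩ := by
          rw [← LinearPMap.map_add]; rfl
        have e2 : (memLp_mul_of_mem_sobolevH0 c (f + g).2.2).toLp _
            = (memLp_mul_of_mem_sobolevH0 c f.2.2).toLp _
              + (memLp_mul_of_mem_sobolevH0 c g.2.2).toLp _ := by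
          rw [← MemLp.toLp_add]
          apply MemLp.toLp_congr
          filter_upwards [Lp.coeFn_add (f : L2 𝕜 L) (g : L2 𝕜 L)] with x hx
          exact (congrArg (c x * ·) hx).trans (mul_add _ _ _)
        rw [e1, e2, add_add_add_comm]
      map_smul' := by
        intro a f
        have e1 : weakDeriv 𝕜 L 2 ⟨_, sobolevH_le_domain le_rfl (a • f).2.1⟩
            = a • weakDeriv 𝕜 L 2 ⟨f, sobolevH_le_domain le_rfl f.2.1⟩ := by
          rw [← LinearPMap.map_smul]; rfl
        have e2 : (memLp_mul_of_mem_sobolevH0 c (a • f).2.2).toLp _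
            = a • (memLp_mul_of_mem_sobolevH0 c f.2.2).toLp _ := by
          rw [← MemLp.toLp_const_smul]
          apply MemLp.toLp_congr
          filter_upwards [Lp.coeFn_smul a (f : L2 𝕜 L)] with x hx
          exact (congrArg (c x * ·) hx).trans (mul_smul_comm a (c x) ((f : L2 𝕜 L) x))
        rw [e1, e2, RingHom.id_apply, smul_add] }

end SturmLiouville

/-!
The operator is reduced to bounded operators on `X = L₂(0, L)`. Let `V f (x) = ∫₀ˣ f` be the
Volterra operator, `P` the orthogonal projection of `X` to the functions of integral zero, and
`B = V P` (`meanZeroVolterra`).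

By the du Bois-Reymond lemma (`mem_span_one_of_isWeakDeriv_zero`) and duality, the derivatives of
test functions are dense in the range of `P` (`meanZero_le_topologicalClosure_testDerivs`).
Hence `H₀¹(0, L)` is the range of `B`, the weak derivative of `V v` being `v`
(`mem_sobolevH0_one_iff`). Testing with `η'` and using `B η' = η` shows that `(B† g)' = -g`, so
`H²(0, L) ∩ H₀¹(0, L)` is the range of `B B†` and `A (B B† g) = -g + c B† g`, where the last term
is the bounded operator `f ↦ c V f` applied to `B† g` (`operatorA_apply`).

For real `t` this gives `(t - A) B B† = 1 + t B B† - C B†` with `C` bounded. The real part of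
`⟪(1 + t B B† - C B†) g, g⟫` is at least `‖g‖² + t ‖B† g‖² - ‖C‖ ‖B† g‖ ‖g‖`, which is at least
`‖g‖² / 2` once `t ≥ ‖C‖² / 2`, so this operator is invertible, by an operator `T` say
(`ContinuousLinearMap.exists_isUnit_one_add_smul_comp_adjoint_sub`), and `B B† T` is the resolvent
of `A` at `t`. It is compact because `V` is (`isCompactOperator_volterra`): primitives of `L₂`
functions are uniformly Hölder continuous, so `V` is a limit of operators of finite rank.
Closedness of `A` follows from the existence of a resolvent; the domain is dense because
`B† f = 0` implies that `f` is orthogonal to every test function.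
-/

/-! ### Bounded operators on a Hilbert space -/

/-- The operator `1 + t B B† - C B†` is invertible for large real `t`: the positive term
`t B B†` absorbs the perturbation, which only sees `B† g`. -/
theorem ContinuousLinearMap.exists_isUnit_one_add_smul_comp_adjoint_sub {𝕜 E : Type*} [RCLike 𝕜]
    [NormedAddCommGroup E] [InnerProductSpace 𝕜 E] [CompleteSpace E] (B C : E →L[𝕜] E) :
    ∃ t : ℝ, IsUnit (1 + (t : 𝕜) • (B ∘L B.adjoint) - C ∘L B.adjoint) := by
  -- with `t = ‖C‖²`, Young's inequality gives `re ⟪S g, g⟫ ≥ ‖g‖² / 2` for this operator `S`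
  refine ⟨‖C‖ ^ 2, isUnit_of_forall_le_norm_inner_map _ (c := 2⁻¹) (by norm_num) fun g => ?_⟩
  have hB : inner 𝕜 (B (B.adjoint g)) g = ((‖B.adjoint g‖ ^ 2 : ℝ) : 𝕜) := by
    rw [← B.adjoint_inner_right, inner_self_eq_norm_sq_to_K]
    push_cast
    rfl
  have hC : RCLike.re (inner 𝕜 (C (B.adjoint g)) g) ≤ ‖C‖ * ‖B.adjoint g‖ * ‖g‖ :=
    (RCLike.re_le_norm _).trans ((norm_inner_le_norm _ _).trans
      (mul_le_mul_of_nonneg_right (C.le_opNorm _) (norm_nonneg _)))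
  have h : RCLike.re (inner 𝕜 ((1 + ((‖C‖ ^ 2 : ℝ) : 𝕜) • (B ∘L B.adjoint) - C ∘L B.adjoint) g) g)
      = ‖g‖ ^ 2 + ‖C‖ ^ 2 * ‖B.adjoint g‖ ^ 2 - RCLike.re (inner 𝕜 (C (B.adjoint g)) g) := by
    simp only [sub_apply, add_apply, one_apply_eq_self, smul_apply, comp_apply, inner_sub_left,
      inner_add_left, inner_smul_left, hB, RCLike.conj_ofReal, map_sub, map_add,
      inner_self_eq_norm_sq, ← RCLike.ofReal_mul, RCLike.ofReal_re]
  refine le_trans ?_ (RCLike.re_le_norm _)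
  rw [h]
  push_cast
  nlinarith [sq_nonneg (‖C‖ * ‖B.adjoint g‖ - ‖g‖), sq_nonneg (‖C‖ * ‖B.adjoint g‖)]

/-- An unbounded operator with a resolvent at some point is closed. -/
theorem LinearPMap.IsResolventAt.isClosed {𝕜 E : Type*} [NontriviallyNormedField 𝕜]
    [NormedAddCommGroup E] [NormedSpace 𝕜 E] {A : E →ₗ.[𝕜] E} {z : 𝕜} {R : E →L[𝕜] E}
    (h : A.IsResolventAt z R) : A.IsClosed := by
  -- the graph is the equalizer of `(u, w) ↦ R (z u - w)` and `(u, w) ↦ u`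
  have hg : (A.graph : Set (E × E)) = {p | R (z • p.1 - p.2) = p.1} := by
    ext ⟨u, w⟩
    simp only [SetLike.mem_coe, LinearPMap.mem_graph_iff, mem_ofPred_eq]
    constructor
    · rintro ⟨y, rfl, rfl⟩
      exact h.2 y
    · intro hu
      obtain ⟨hm, he⟩ := h.1 (z • u - w)
      refine ⟨⟨_, hm⟩, hu, ?_⟩
      exact sub_right_injective (he.trans (congrArg (z • · - w) hu.symm))
  rw [LinearPMap.IsClosed, hg]
  exact isClosed_eq (by fun_prop) continuous_fst

namespace SturmLiouville

variable {𝕜 : Type*} [RCLike 𝕜] {L : ℝ}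

/-! ### The integration operator -/

/-- The primitive `x ↦ ∫₀ˣ f` of `f ∈ L₂(0, L)`, as a function on all of `ℝ`: the measure lives on
`(0, L)`, so it vanishes for `x ≤ 0` and is constant for `x ≥ L`. -/
noncomputable def prim (f : L2 𝕜 L) (x : ℝ) : 𝕜 := ∫ t in Iic x, f t ∂intervalMeasure L

variable (𝕜 L) in
/-- The constant function `1` in `L₂(0, L)`. -/
noncomputable def one : L2 𝕜 L := Lp.const 2 (intervalMeasure L) 1

theorem coeFn_one : one 𝕜 L =ᵐ[intervalMeasure L] fun _ => 1 := Lp.coeFn_const ..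

theorem inner_one (f : L2 𝕜 L) : inner 𝕜 (one 𝕜 L) f = ∫ x in Ioo 0 L, f x := by
  rw [one, ← indicatorConstLp_univ, L2.inner_indicatorConstLp_one, Measure.restrict_univ]

theorem prim_eq_inner (f : L2 𝕜 L) (x : ℝ) :
    prim f x = inner 𝕜 (indicatorConstLp 2 measurableSet_Iic
      (measure_ne_top (intervalMeasure L) (Iic x)) (1 : 𝕜)) f :=
  (L2.inner_indicatorConstLp_one ..).symm

theorem norm_setIntegral_le (f : L2 𝕜 L) {s : Set ℝ} (hs : MeasurableSet s) :
    ‖∫ t in s, f t ∂intervalMeasure L‖ ≤ √((intervalMeasure L).real s) * ‖f‖ := by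
  rw [← L2.inner_indicatorConstLp_one hs (measure_ne_top (intervalMeasure L) s)]
  refine (norm_inner_le_norm _ _).trans (mul_le_mul_of_nonneg_right ?_ (norm_nonneg _))
  rw [norm_indicatorConstLp (by simp) (by simp), Real.sqrt_eq_rpow]
  simp

theorem norm_prim_sub_le (f : L2 𝕜 L) (x y : ℝ) :
    ‖prim f y - prim f x‖ ≤ √|y - x| * ‖f‖ := by
  wlog hxy : x ≤ y generalizing x y
  · rw [norm_sub_rev, abs_sub_comm]
    exact this y x (le_of_not_ge hxy)
  have hint : Integrable f (intervalMeasure L) := (Lp.memLp f).integrable one_le_two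
  rw [prim, prim, intervalIntegral.integral_Iic_sub_Iic hint.integrableOn hint.integrableOn,
    intervalIntegral.integral_of_le hxy]
  refine (norm_setIntegral_le f measurableSet_Ioc).trans
    (mul_le_mul_of_nonneg_right (Real.sqrt_le_sqrt ?_) (norm_nonneg _))
  calc (intervalMeasure L).real (Ioc x y) ≤ volume.real (Ioc x y) :=
        ENNReal.toReal_mono (by simp) (Measure.restrict_apply_le _ _)
    _ = |y - x| := by rw [Real.volume_real_Ioc_of_le hxy, abs_of_nonneg (sub_nonneg.2 hxy)]

theorem norm_prim_le (f : L2 𝕜 L) (x : ℝ) :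
    ‖prim f x‖ ≤ √((intervalMeasure L).real univ) * ‖f‖ :=
  (norm_setIntegral_le f measurableSet_Iic).trans
    (mul_le_mul_of_nonneg_right (Real.sqrt_le_sqrt (measureReal_mono (subset_univ _)))
      (norm_nonneg _))

theorem continuous_prim (f : L2 𝕜 L) : Continuous (prim f) := by
  refine continuous_iff_continuousAt.2 fun x => tendsto_iff_norm_sub_tendsto_zero.2 ?_
  refine squeeze_zero (fun _ => norm_nonneg _) (fun y => norm_prim_sub_le f x y) ?_
  have : Continuous fun y : ℝ => √|y - x| * ‖f‖ := by fun_prop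
  simpa using this.tendsto x

theorem memLp_mul_prim (c f : L2 𝕜 L) : MemLp (fun x => c x * prim f x) 2 (intervalMeasure L) := by
  refine (Lp.memLp c).of_le_mul (c := √((intervalMeasure L).real univ) * ‖f‖)
    ((Lp.aestronglyMeasurable c).mul (continuous_prim f).aestronglyMeasurable)
    (ae_of_all _ fun x => ?_)
  rw [norm_mul, mul_comm]
  exact mul_le_mul_of_nonneg_right (norm_prim_le f x) (norm_nonneg _)

/-- The bounded operator `f ↦ c ∫₀ˣ f` on `L₂(0, L)`; for `c = 1` it is the Volterra operator. -/
noncomputable def mulPrim (c : L2 𝕜 L) : L2 𝕜 L →L[𝕜] L2 𝕜 L :=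
  LinearMap.mkContinuous
    { toFun := fun f => (memLp_mul_prim c f).toLp _
      map_add' := fun f g => by
        rw [← MemLp.toLp_add]
        refine MemLp.toLp_congr _ _ (ae_of_all _ fun x => ?_)
        simp only [prim_eq_inner, inner_add_right, mul_add, Pi.add_apply]
      map_smul' := fun a f => by
        rw [RingHom.id_apply, ← MemLp.toLp_const_smul]
        refine MemLp.toLp_congr _ _ (ae_of_all _ fun x => ?_)
        simp only [prim_eq_inner, inner_smul_right, Pi.smul_apply, smul_eq_mul]
        ring }
    (√((intervalMeasure L).real univ) * ‖c‖) fun f => by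
      rw [mul_right_comm]
      refine Lp.norm_le_mul_norm_of_ae_le_mul ?_
      filter_upwards [(memLp_mul_prim c f).coeFn_toLp] with x hx
      refine (congrArg _ hx).trans_le ?_
      rw [norm_mul, mul_comm]
      exact mul_le_mul_of_nonneg_right (norm_prim_le f x) (norm_nonneg _)

theorem coeFn_mulPrim (c f : L2 𝕜 L) :
    mulPrim c f =ᵐ[intervalMeasure L] fun x => c x * prim f x :=
  (memLp_mul_prim c f).coeFn_toLp

variable (𝕜 L) in
/-- The Volterra operator `f ↦ ∫₀ˣ f` on `L₂(0, L)`. -/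
noncomputable def volterra : L2 𝕜 L →L[𝕜] L2 𝕜 L := mulPrim (one 𝕜 L)

theorem coeFn_volterra (f : L2 𝕜 L) : volterra 𝕜 L f =ᵐ[intervalMeasure L] prim f := by
  filter_upwards [coeFn_mulPrim (one 𝕜 L) f, coeFn_one (𝕜 := 𝕜) (L := L)] with x hx h1
  rw [volterra, hx, h1, one_mul]

/-- Sampling primitives at the points `i / m` approximates the Volterra operator by operators
of finite rank, since primitives of `L₂` functions are Hölder continuous of exponent `1 / 2`. -/
theorem exists_isCompactOperator_norm_volterra_sub_le (m : ℕ) :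
    ∃ F : L2 𝕜 L →L[𝕜] L2 𝕜 L, IsCompactOperator F ∧
      ‖volterra 𝕜 L - F‖ ≤ √(1 / ((m : ℝ) + 1)) * ‖one 𝕜 L‖ := by
  set N : ℕ := ⌊((m : ℝ) + 1) * L⌋₊
  have hmeas (a : Fin (N + 1) → 𝕜) :
      Measurable fun x : ℝ => a (Fin.ofNat (N + 1) ⌊((m : ℝ) + 1) * x⌋₊) :=
    (measurable_of_countable fun k : ℕ => a (Fin.ofNat (N + 1) k)).comp
      (Nat.measurable_floor.comp (measurable_const.mul measurable_id))
  have hmem (a : Fin (N + 1) → 𝕜) :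
      MemLp (fun x : ℝ => a (Fin.ofNat (N + 1) ⌊((m : ℝ) + 1) * x⌋₊)) 2 (intervalMeasure L) :=
    MemLp.of_bound (hmeas a).aestronglyMeasurable ‖a‖ (ae_of_all _ fun x => norm_le_pi_norm a _)
  -- step functions with given values on the grid
  let step : (Fin (N + 1) → 𝕜) →ₗ[𝕜] L2 𝕜 L :=
    { toFun := fun a => (hmem a).toLp _
      map_add' := fun a b => (MemLp.toLp_add (hmem a) (hmem b)).symm ▸ rfl
      map_smul' := fun r a => (MemLp.toLp_const_smul r (hmem a)).symm ▸ rfl }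
  let sample : L2 𝕜 L →L[𝕜] (Fin (N + 1) → 𝕜) := ContinuousLinearMap.pi fun i =>
    innerSL 𝕜 (indicatorConstLp 2 measurableSet_Iic
      (measure_ne_top (intervalMeasure L) (Iic ((i : ℝ) / ((m : ℝ) + 1)))) (1 : 𝕜))
  have hsample (f : L2 𝕜 L) (i : Fin (N + 1)) :
      sample f i = prim f ((i : ℝ) / ((m : ℝ) + 1)) := (prim_eq_inner ..).symm
  refine ⟨LinearMap.toContinuousLinearMap step ∘L sample, ?_, ?_⟩
  · exact (isCompactOperator_of_locallyCompactSpace_rng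
      (T := LinearMap.toContinuousLinearMap step)).comp_clm sample
  refine ContinuousLinearMap.opNorm_le_bound _ (by positivity) fun f => ?_
  rw [mul_right_comm]
  refine Lp.norm_le_mul_norm_of_ae_le_mul ?_
  filter_upwards [Lp.coeFn_sub (volterra 𝕜 L f) (step (sample f)), coeFn_volterra f,
    (hmem (sample f)).coeFn_toLp, coeFn_one (𝕜 := 𝕜) (L := L), ae_restrict_mem measurableSet_Ioo]
    with x h1 h2 h3 h4 hx
  have hm : (0 : ℝ) < (m : ℝ) + 1 := by positivity
  have hk : ⌊((m : ℝ) + 1) * x⌋₊ < N + 1 :=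
    Nat.lt_succ_of_le (Nat.floor_mono (mul_le_mul_of_nonneg_left hx.2.le hm.le))
  refine (congrArg _ (h1.trans (congrArg₂ (· - ·) h2 h3))).trans_le ?_
  rw [h4, norm_one, mul_one, hsample]
  refine (norm_prim_sub_le f _ _).trans
    (mul_le_mul_of_nonneg_right (Real.sqrt_le_sqrt ?_) (norm_nonneg _))
  rw [Fin.val_ofNat, Nat.mod_eq_of_lt hk]
  have hl := Nat.floor_le (mul_nonneg hm.le hx.1.le)
  have hu := Nat.lt_floor_add_one (((m : ℝ) + 1) * x)
  rw [abs_of_nonneg (sub_nonneg.2 ((div_le_iff₀' hm).2 hl)), sub_le_iff_le_add', ← add_div,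
    le_div_iff₀' hm]
  exact hu.le

theorem isCompactOperator_volterra : IsCompactOperator (volterra 𝕜 L) := by
  choose F hF hle using exists_isCompactOperator_norm_volterra_sub_le (𝕜 := 𝕜) (L := L)
  refine isCompactOperator_of_tendsto (F := F) (l := atTop) ?_ (Eventually.of_forall hF)
  refine tendsto_iff_norm_sub_tendsto_zero.2 (squeeze_zero (fun _ => norm_nonneg _)
    (fun m => (norm_sub_rev _ _).trans_le (hle m)) ?_)
  simpa using (tendsto_one_div_add_atTop_nhds_zero_nat (𝕜 := ℝ)).sqrt.mul_const ‖one 𝕜 L‖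

/-! ### Test functions and the du Bois-Reymond lemma -/

theorem IsTestFunction.deriv {η : ℝ → ℝ} (h : IsTestFunction L η) :
    IsTestFunction L (_root_.deriv η) :=
  ⟨(contDiff_infty_iff_deriv.1 h.1).2, h.2.1.deriv, (tsupport_deriv_subset (f := η)).trans h.2.2⟩

variable (𝕜) in
/-- A real test function as an element of the `𝕜`-valued space `L₂(0, L)`. -/
noncomputable def IsTestFunction.toL2 {η : ℝ → ℝ} (h : IsTestFunction L η) : L2 𝕜 L :=
  (memLp_of_continuous_of_hasCompactSupport (F := 𝕜) (η := fun x => η x • (1 : 𝕜))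
    (h.1.continuous.smul continuous_const) h.2.1.smul_right 2).toLp _

theorem IsTestFunction.coeFn_toL2 {η : ℝ → ℝ} (h : IsTestFunction L η) :
    h.toL2 𝕜 =ᵐ[intervalMeasure L] fun x => η x • (1 : 𝕜) :=
  MemLp.coeFn_toLp _

theorem IsTestFunction.inner_toL2 {η : ℝ → ℝ} (h : IsTestFunction L η) (f : L2 𝕜 L) :
    inner 𝕜 (h.toL2 𝕜) f = ∫ x in Ioo 0 L, η x • f x := by
  rw [L2.inner_def]
  refine integral_congr_ae ?_
  filter_upwards [h.coeFn_toL2 (𝕜 := 𝕜)] with x hx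
  rw [hx, RCLike.inner_apply, RCLike.real_smul_eq_coe_mul, RCLike.real_smul_eq_coe_mul]
  simp [mul_comm]

theorem isWeakDeriv_one_iff {f g : L2 𝕜 L} : IsWeakDeriv 1 f g ↔
    ∀ η (h : IsTestFunction L η), inner 𝕜 (h.deriv.toL2 𝕜) f = -inner 𝕜 (h.toL2 𝕜) g := by
  simp only [IsTestFunction.inner_toL2, IsWeakDeriv, iteratedDeriv_one, pow_one, neg_smul, one_smul]

theorem isWeakDeriv_two_iff {f g : L2 𝕜 L} : IsWeakDeriv 2 f g ↔
    ∀ η (h : IsTestFunction L η), inner 𝕜 (h.deriv.deriv.toL2 𝕜) f = inner 𝕜 (h.toL2 𝕜) g := by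
  simp only [IsTestFunction.inner_toL2, IsWeakDeriv, iteratedDeriv_succ, iteratedDeriv_zero,
    neg_one_sq, one_smul]

theorem isWeakDeriv_zero_self (f : L2 𝕜 L) : IsWeakDeriv 0 f f := fun η _ => by simp

theorem eq_zero_of_forall_inner_toL2_eq_zero {f : L2 𝕜 L}
    (hf : ∀ η (h : IsTestFunction L η), inner 𝕜 (h.toL2 𝕜) f = 0) : f = 0 := by
  refine weakDerivGraph_functional 0 (0, f) (fun η hη => ?_) rfl
  rw [iteratedDeriv_zero, ← hη.inner_toL2, ← hη.inner_toL2, hf η hη, inner_zero_right, smul_zero]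

theorem exists_isTestFunction_integral_eq_one (hL : 0 < L) :
    ∃ ρ, IsTestFunction L ρ ∧ ∫ x in Ioo 0 L, ρ x = 1 := by
  let b : ContDiffBump (L / 2) := ⟨L / 8, L / 4, by positivity, by linarith⟩
  have hs : tsupport (b.normed volume) ⊆ Ioo 0 L := by
    rw [b.tsupport_normed_eq, Real.closedBall_eq_Icc]
    refine Icc_subset_Ioo ?_ ?_ <;> simp only [b] <;> linarith
  refine ⟨b.normed volume, ⟨b.contDiff_normed, b.hasCompactSupport_normed, hs⟩, ?_⟩
  rw [setIntegral_eq_integral_of_forall_compl_eq_zero, b.integral_normed]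
  exact fun x hx => image_eq_zero_of_notMem_tsupport fun h => hx (hs h)

/-- A test function of integral zero is the derivative of a test function. -/
theorem IsTestFunction.exists_deriv_eq (hL : 0 < L) {θ : ℝ → ℝ} (h : IsTestFunction L θ)
    (h0 : ∫ x in Ioo 0 L, θ x = 0) : ∃ ζ, IsTestFunction L ζ ∧ _root_.deriv ζ = θ := by
  have hc : Continuous θ := h.1.continuous
  have hd : _root_.deriv (fun x => ∫ t in (0 : ℝ)..x, θ t) = θ :=
    funext fun x => hc.deriv_integral θ 0 x
  -- adding a point makes the support nonempty, so that it has a least and a greatest element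
  have hK : IsCompact (insert (L / 2) (tsupport θ)) := h.2.1.isCompact.insert _
  have hKL : insert (L / 2) (tsupport θ) ⊆ Ioo 0 L :=
    insert_subset ⟨by linarith, by linarith⟩ h.2.2
  obtain ⟨a, haK, ha⟩ := hK.exists_isLeast (insert_nonempty _ _)
  obtain ⟨b, hbK, hb⟩ := hK.exists_isGreatest (insert_nonempty _ _)
  have hlo : ∀ t < a, θ t = 0 := fun t ht =>
    image_eq_zero_of_notMem_tsupport fun hm => ht.not_ge (ha (mem_insert_of_mem _ hm))
  have hhi : ∀ t, b < t → θ t = 0 := fun t ht =>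
    image_eq_zero_of_notMem_tsupport fun hm => ht.not_ge (hb (mem_insert_of_mem _ hm))
  have hs : Function.support (fun x => ∫ t in (0 : ℝ)..x, θ t) ⊆ Icc a b := by
    intro x hx
    by_contra hx'
    refine hx ?_
    rcases lt_or_ge x a with hxa | hxa
    · refine intervalIntegral.integral_zero_ae (ae_of_all _ fun t ht => hlo t ?_)
      exact (ht.2).trans_lt (max_lt (hKL haK).1 hxa)
    · have hbx : b < x := lt_of_not_ge fun hxb => hx' ⟨hxa, hxb⟩
      change ∫ t in (0 : ℝ)..x, θ t = 0
      rw [← intervalIntegral.integral_add_adjacent_intervals (b := L)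
        (hc.intervalIntegrable _ _) (hc.intervalIntegrable _ _),
        intervalIntegral.integral_of_le hL.le, integral_Ioc_eq_integral_Ioo, h0, zero_add]
      refine intervalIntegral.integral_zero_ae (ae_of_all _ fun t ht => hhi t ?_)
      exact (lt_min (hKL hbK).2 hbx).trans ht.1
  refine ⟨_, ⟨?_, HasCompactSupport.of_support_subset_isCompact isCompact_Icc hs, ?_⟩, hd⟩
  · rw [contDiff_infty_iff_deriv, hd]
    exact ⟨fun x => (hc.integral_hasStrictDerivAt 0 x).hasDerivAt.differentiableAt, h.1⟩
  · exact (closure_minimal hs isClosed_Icc).trans (Icc_subset_Ioo (hKL haK).1 (hKL hbK).2)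

/-- The du Bois-Reymond lemma: a function with vanishing weak derivative is constant. -/
theorem mem_span_one_of_isWeakDeriv_zero (hL : 0 < L) {f : L2 𝕜 L} (hf : IsWeakDeriv 1 f 0) :
    f ∈ 𝕜 ∙ one 𝕜 L := by
  obtain ⟨ρ, hρ, hρ1⟩ := exists_isTestFunction_integral_eq_one hL
  refine Submodule.mem_span_singleton.2 ⟨inner 𝕜 (hρ.toL2 𝕜) f, ?_⟩
  rw [eq_comm, ← sub_eq_zero]
  refine eq_zero_of_forall_inner_toL2_eq_zero fun η hη => ?_
  have hint {ξ : ℝ → ℝ} (hξ : IsTestFunction L ξ) : Integrable ξ (intervalMeasure L) :=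
    (hξ.1.continuous.integrable_of_hasCompactSupport hξ.2.1).integrableOn
  set m : ℝ := ∫ x in Ioo 0 L, η x with hm
  -- `η - m ρ` has integral zero, so it is a derivative and annihilates `f`
  have hθ : IsTestFunction L (fun x => η x - m * ρ x) :=
    ⟨hη.1.sub (contDiff_const.mul hρ.1), hη.2.1.sub hρ.2.1.mul_left,
      (tsupport_sub _ _).trans (union_subset hη.2.2
        ((tsupport_mul_subset_right).trans hρ.2.2))⟩
  obtain ⟨ζ, hζ, hζθ⟩ := hθ.exists_deriv_eq hL (by
    rw [integral_sub (hint hη) ((hint hρ).const_mul m), integral_const_mul, hρ1, mul_one, ← hm,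
      sub_self])
  have hζf : inner 𝕜 (hζ.deriv.toL2 𝕜) f = 0 := by
    rw [isWeakDeriv_one_iff.1 hf ζ hζ, inner_zero_right, neg_zero]
  have he : hζ.deriv.toL2 𝕜 = hη.toL2 𝕜 - (m : 𝕜) • hρ.toL2 𝕜 := by
    refine Lp.ext ?_
    filter_upwards [hζ.deriv.coeFn_toL2 (𝕜 := 𝕜), hη.coeFn_toL2 (𝕜 := 𝕜),
      hρ.coeFn_toL2 (𝕜 := 𝕜), Lp.coeFn_sub (hη.toL2 𝕜) ((m : 𝕜) • hρ.toL2 𝕜),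
      Lp.coeFn_smul (m : 𝕜) (hρ.toL2 𝕜)] with x h1 h2 h3 h4 h5
    rw [h1, h4, Pi.sub_apply, h5, Pi.smul_apply, h2, h3, hζθ]
    simp [RCLike.real_smul_eq_coe_mul]
  have hη1 : inner 𝕜 (hη.toL2 𝕜) (one 𝕜 L) = (m : 𝕜) := by
    rw [hη.inner_toL2, hm, ← integral_ofReal]
    refine integral_congr_ae ?_
    filter_upwards [coeFn_one (𝕜 := 𝕜) (L := L)] with x hx
    rw [hx, RCLike.real_smul_eq_coe_mul, mul_one]
  rw [he, inner_sub_left, inner_smul_left, RCLike.conj_ofReal] at hζf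
  rw [inner_sub_right, inner_smul_right, hη1, mul_comm]
  exact hζf

variable (𝕜 L) in
/-- The derivatives of the `𝕜`-valued continuously differentiable functions with compact support
in `(0, L)`. -/
noncomputable def testDerivs : Submodule 𝕜 (L2 𝕜 L) where
  carrier := {w | ∃ ψ : ℝ → 𝕜, ContDiff ℝ 1 ψ ∧ HasCompactSupport ψ ∧ tsupport ψ ⊆ Ioo 0 L ∧
    w =ᵐ[intervalMeasure L] deriv ψ}
  zero_mem' := by
    refine ⟨0, contDiff_const, HasCompactSupport.zero, ?_, ?_⟩
    · simp [tsupport]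
    · simpa using Lp.coeFn_zero 𝕜 2 (intervalMeasure L)
  add_mem' := by
    rintro w v ⟨ψ, a1, a2, a3, a4⟩ ⟨φ, b1, b2, b3, b4⟩
    refine ⟨ψ + φ, a1.add b1, a2.add b2, (tsupport_add ψ φ).trans (union_subset a3 b3), ?_⟩
    filter_upwards [Lp.coeFn_add w v, a4, b4] with x h h1 h2
    rw [h, Pi.add_apply, h1, h2, deriv_add (a1.differentiable one_ne_zero x)
      (b1.differentiable one_ne_zero x)]
  smul_mem' := by
    rintro a w ⟨ψ, a1, a2, a3, a4⟩
    refine ⟨a • ψ, a1.const_smul a, a2.mono (Function.support_const_smul_subset a ψ),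
      (closure_mono (Function.support_const_smul_subset a ψ)).trans a3, ?_⟩
    filter_upwards [Lp.coeFn_smul a w, a4] with x h h1
    rw [h, Pi.smul_apply, h1, deriv_const_smul _ (a1.differentiable one_ne_zero x)]

theorem IsTestFunction.smul_one {η : ℝ → ℝ} (h : IsTestFunction L η) :
    ContDiff ℝ 1 (fun x => η x • (1 : 𝕜)) ∧ HasCompactSupport (fun x => η x • (1 : 𝕜)) ∧
      tsupport (fun x => η x • (1 : 𝕜)) ⊆ Ioo 0 L ∧
      h.deriv.toL2 𝕜 =ᵐ[intervalMeasure L] _root_.deriv fun x => η x • (1 : 𝕜) := by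
  refine ⟨(h.1.of_le (by simp)).smul contDiff_const, h.2.1.smul_right,
    (closure_mono (Function.support_smul_subset_left _ _)).trans h.2.2, ?_⟩
  filter_upwards [h.deriv.coeFn_toL2 (𝕜 := 𝕜)] with x hx
  rw [hx, (((h.1.differentiable (by simp)) x).hasDerivAt.smul_const (1 : 𝕜)).deriv]

theorem IsTestFunction.toL2_deriv_mem_testDerivs {η : ℝ → ℝ} (h : IsTestFunction L η) :
    h.deriv.toL2 𝕜 ∈ testDerivs 𝕜 L :=
  ⟨_, h.smul_one⟩

theorem prim_eq_of_ae_eq_deriv {ψ : ℝ → 𝕜} (h1 : ContDiff ℝ 1 ψ) (hs : HasCompactSupport ψ)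
    (hL : tsupport ψ ⊆ Ioo 0 L) {w : L2 𝕜 L} (hw : w =ᵐ[intervalMeasure L] deriv ψ) (x : ℝ) :
    prim w x = ψ x := by
  rw [prim, integral_congr_ae (ae_restrict_of_ae hw), Measure.restrict_restrict measurableSet_Iic,
    ← setIntegral_eq_of_subset_of_forall_sdiff_eq_zero measurableSet_Iic inter_subset_left,
    hs.integral_Iic_deriv_eq h1]
  exact fun t ht => image_eq_zero_of_notMem_tsupport fun hm =>
    ht.2 ⟨ht.1, hL (tsupport_deriv_subset hm)⟩

theorem inner_one_eq_prim (f : L2 𝕜 L) : inner 𝕜 (one 𝕜 L) f = prim f L := by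
  rw [inner_one, prim, Measure.restrict_restrict measurableSet_Iic,
    inter_eq_self_of_subset_right fun x hx => hx.2.le]

theorem volterra_eq_of_ae_eq_deriv {ψ : ℝ → 𝕜} (h1 : ContDiff ℝ 1 ψ) (hs : HasCompactSupport ψ)
    (hL : tsupport ψ ⊆ Ioo 0 L) {w u : L2 𝕜 L} (hw : w =ᵐ[intervalMeasure L] deriv ψ)
    (hu : u =ᵐ[intervalMeasure L] ψ) : volterra 𝕜 L w = u := by
  refine Lp.ext ?_
  filter_upwards [coeFn_volterra w, hu] with x hx hx'
  rw [hx, hx', prim_eq_of_ae_eq_deriv h1 hs hL hw]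

theorem volterra_toL2_deriv {η : ℝ → ℝ} (h : IsTestFunction L η) :
    volterra 𝕜 L (h.deriv.toL2 𝕜) = h.toL2 𝕜 :=
  have ⟨h1, hs, hL, hd⟩ := h.smul_one (𝕜 := 𝕜)
  volterra_eq_of_ae_eq_deriv h1 hs hL hd h.coeFn_toL2

variable (𝕜 L) in
/-- The functions in `L₂(0, L)` of integral zero. -/
noncomputable abbrev meanZero : Submodule 𝕜 (L2 𝕜 L) := (𝕜 ∙ one 𝕜 L)ᗮ

theorem testDerivs_le_meanZero : testDerivs 𝕜 L ≤ meanZero 𝕜 L := by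
  rintro w ⟨ψ, h1, hs, hL, hw⟩
  rw [Submodule.mem_orthogonal_singleton_iff_inner_right, inner_one_eq_prim,
    prim_eq_of_ae_eq_deriv h1 hs hL hw]
  exact image_eq_zero_of_notMem_tsupport fun h => lt_irrefl _ (hL h).2

theorem meanZero_le_topologicalClosure_testDerivs (hL : 0 < L) :
    meanZero 𝕜 L ≤ (testDerivs 𝕜 L).topologicalClosure := by
  rw [← Submodule.orthogonal_orthogonal_eq_closure]
  refine Submodule.orthogonal_le fun f hf => mem_span_one_of_isWeakDeriv_zero hL ?_
  refine isWeakDeriv_one_iff.2 fun η h => ?_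
  rw [inner_zero_right, neg_zero]
  exact hf _ h.toL2_deriv_mem_testDerivs

/-! ### The space `H₀¹(0, L)` and the domain of `∂ₓₓ` -/

/-- Integration inverts weak differentiation on functions of integral zero. For derivatives of
test functions this is classical, and both sides of the defining identity are continuous. -/
theorem isWeakDeriv_one_volterra (hL : 0 < L) {v : L2 𝕜 L} (hv : v ∈ meanZero 𝕜 L) :
    IsWeakDeriv 1 (volterra 𝕜 L v) v := by
  refine isWeakDeriv_one_iff.2 fun η h => ?_
  have hcl : IsClosed {w : L2 𝕜 L |
      inner 𝕜 (h.deriv.toL2 𝕜) (volterra 𝕜 L w) = -inner 𝕜 (h.toL2 𝕜) w} :=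
    isClosed_eq (by fun_prop) (by fun_prop)
  refine closure_minimal ?_ hcl (meanZero_le_topologicalClosure_testDerivs hL hv)
  rintro w ⟨ψ, h1, hs, hL, hw⟩
  refine isWeakDeriv_one_iff.1 (isWeakDeriv_one_of_contDiff h1 hs hL ?_ hw) η h
  filter_upwards [coeFn_volterra w] with x hx
  rw [hx, prim_eq_of_ae_eq_deriv h1 hs hL hw]

theorem weakDeriv_zero_apply (f : (weakDeriv 𝕜 L 0).domain) : weakDeriv 𝕜 L 0 f = f :=
  weakDeriv_eq_of_isWeakDeriv f (isWeakDeriv_zero_self _)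

theorem mem_sobolevH_one {f g : L2 𝕜 L} (h : IsWeakDeriv 1 f g) : f ∈ sobolevH 𝕜 L 1 := by
  refine mem_sobolevH_iff.2 fun j hj => ?_
  interval_cases j
  exacts [⟨f, isWeakDeriv_zero_self f⟩, ⟨g, h⟩]

theorem sobolevNorm_one_eq {f : sobolevH 𝕜 L 1} {g : L2 𝕜 L} (h : IsWeakDeriv 1 (f : L2 𝕜 L) g) :
    sobolevNorm 𝕜 L 1 f = √(‖(f : L2 𝕜 L)‖ ^ 2 + ‖g‖ ^ 2) := by
  rw [sobolevNorm_eq, Fin.sum_univ_two]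
  congr 4
  · exact weakDeriv_zero_apply _
  · exact weakDeriv_eq_of_isWeakDeriv (k := 1)
      ⟨(f : L2 𝕜 L), sobolevH_le_domain (j := 1) le_rfl f.2⟩ h

/-- `H₀¹(0, L)` consists of the primitives of the functions of integral zero. -/
theorem mem_sobolevH0_one_iff (hL : 0 < L) {f : L2 𝕜 L} :
    f ∈ sobolevH0 𝕜 L 1 ↔ ∃ v ∈ meanZero 𝕜 L, volterra 𝕜 L v = f := by
  constructor
  · rintro ⟨hf, happ⟩
    obtain ⟨g, hg⟩ := mem_sobolevH_iff.1 hf 1 le_rfl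
    choose φ hφ hlt using fun n : ℕ => happ (1 / ((n : ℝ) + 1)) (by positivity)
    -- the approximants are primitives of elements `w n` of `testDerivs`
    have hw (n : ℕ) : ∃ w ∈ testDerivs 𝕜 L, IsWeakDeriv 1 (φ n : L2 𝕜 L) w ∧
        volterra 𝕜 L w = φ n := by
      obtain ⟨ψ, h1, hs, hL, hu⟩ := hφ n
      have h1' : ContDiff ℝ 1 ψ := by exact_mod_cast h1
      have hm := (memLp_of_continuous_of_hasCompactSupport (L := L)
        (h1'.continuous_deriv le_rfl) hs.deriv 2).coeFn_toLp
      exact ⟨_, ⟨ψ, h1', hs, hL, hm⟩, isWeakDeriv_one_of_contDiff h1' hs hL hu hm,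
        volterra_eq_of_ae_eq_deriv h1' hs hL hm hu⟩
    choose w hwT hwd hwV using hw
    have hn (n : ℕ) : √(‖f - φ n‖ ^ 2 + ‖g - w n‖ ^ 2) ≤ 1 / ((n : ℝ) + 1) := by
      have hd := (weakDerivGraph 𝕜 L 1).sub_mem (x := (f, g))
        (y := ((φ n : L2 𝕜 L), w n)) hg (hwd n)
      exact (sobolevNorm_one_eq (f := (⟨f, hf⟩ : sobolevH 𝕜 L 1) - φ n) hd).ge.trans (hlt n).le
    have hφf : Tendsto (fun n => (φ n : L2 𝕜 L)) atTop (𝓝 f) := by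
      refine tendsto_iff_norm_sub_tendsto_zero.2 (squeeze_zero (fun _ => norm_nonneg _)
        (fun n => le_trans ?_ (hn n)) tendsto_one_div_add_atTop_nhds_zero_nat)
      rw [norm_sub_rev]
      exact Real.le_sqrt_of_sq_le (le_add_of_nonneg_right (sq_nonneg _))
    have hwg : Tendsto w atTop (𝓝 g) := by
      refine tendsto_iff_norm_sub_tendsto_zero.2 (squeeze_zero (fun _ => norm_nonneg _)
        (fun n => le_trans ?_ (hn n)) tendsto_one_div_add_atTop_nhds_zero_nat)
      rw [norm_sub_rev]
      exact Real.le_sqrt_of_sq_le (le_add_of_nonneg_left (sq_nonneg _))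
    refine ⟨g, ?_, ?_⟩
    · exact (Submodule.isClosed_orthogonal _).mem_of_tendsto hwg
        (Eventually.of_forall fun n => testDerivs_le_meanZero (hwT n))
    · refine tendsto_nhds_unique (((volterra 𝕜 L).continuous.tendsto g).comp hwg) ?_
      simpa only [Function.comp_def, hwV] using hφf
  · rintro ⟨v, hv, rfl⟩
    refine ⟨mem_sobolevH_one (isWeakDeriv_one_volterra hL hv), fun ε hε => ?_⟩
    have hcont : Continuous fun w : L2 𝕜 L => √(‖volterra 𝕜 L (v - w)‖ ^ 2 + ‖v - w‖ ^ 2) := by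
      fun_prop
    obtain ⟨w, hwε, hwT⟩ := mem_closure_iff.1 (meanZero_le_topologicalClosure_testDerivs hL hv)
      _ (isOpen_Iio.preimage hcont) (show v ∈ _ ⁻¹' Iio ε by simpa using hε)
    have hw := testDerivs_le_meanZero hwT
    refine ⟨⟨volterra 𝕜 L w, mem_sobolevH_one (isWeakDeriv_one_volterra hL hw)⟩, ?_, ?_⟩
    · obtain ⟨ψ, h1, hs, hL, hd⟩ := hwT
      refine ⟨ψ, by exact_mod_cast h1, hs, hL, ?_⟩
      filter_upwards [coeFn_volterra w] with x hx
      rw [hx, prim_eq_of_ae_eq_deriv h1 hs hL hd]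
    · rw [sobolevNorm_one_eq (g := v - w)]
      · change √(‖volterra 𝕜 L v - volterra 𝕜 L w‖ ^ 2 + ‖v - w‖ ^ 2) < ε
        rw [← map_sub]
        exact hwε
      · change IsWeakDeriv 1 (volterra 𝕜 L v - volterra 𝕜 L w) (v - w)
        rw [← map_sub]
        exact isWeakDeriv_one_volterra hL (sub_mem hv hw)

variable (𝕜 L) in
/-- The Volterra operator preceded by the projection to the functions of integral zero. It
is an isomorphism from the functions of integral zero to `H₀¹(0, L)`. -/
noncomputable def meanZeroVolterra : L2 𝕜 L →L[𝕜] L2 𝕜 L :=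
  volterra 𝕜 L ∘L (meanZero 𝕜 L).starProjection

theorem adjoint_meanZeroVolterra_apply (g : L2 𝕜 L) : (meanZeroVolterra 𝕜 L).adjoint g =
    (meanZero 𝕜 L).starProjection ((volterra 𝕜 L).adjoint g) := by
  refine ext_inner_left 𝕜 fun f => ?_
  rw [ContinuousLinearMap.adjoint_inner_right, meanZeroVolterra,
    ← Submodule.inner_starProjection_left_eq_right, ContinuousLinearMap.adjoint_inner_right]
  rfl

theorem adjoint_meanZeroVolterra_mem (g : L2 𝕜 L) :
    (meanZeroVolterra 𝕜 L).adjoint g ∈ meanZero 𝕜 L := by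
  rw [adjoint_meanZeroVolterra_apply]
  exact Submodule.starProjection_apply_mem _ _

theorem meanZeroVolterra_apply_of_mem {v : L2 𝕜 L} (hv : v ∈ meanZero 𝕜 L) :
    meanZeroVolterra 𝕜 L v = volterra 𝕜 L v :=
  congrArg (volterra 𝕜 L) (Submodule.starProjection_eq_self_iff.2 hv)

theorem meanZeroVolterra_toL2_deriv {η : ℝ → ℝ} (h : IsTestFunction L η) :
    meanZeroVolterra 𝕜 L (h.deriv.toL2 𝕜) = h.toL2 𝕜 := by
  rw [meanZeroVolterra_apply_of_mem (testDerivs_le_meanZero h.toL2_deriv_mem_testDerivs),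
    volterra_toL2_deriv]

theorem inner_toL2_deriv_adjoint_meanZeroVolterra {η : ℝ → ℝ} (h : IsTestFunction L η)
    (g : L2 𝕜 L) : inner 𝕜 (h.deriv.toL2 𝕜) ((meanZeroVolterra 𝕜 L).adjoint g) =
      inner 𝕜 (h.toL2 𝕜) g := by
  rw [ContinuousLinearMap.adjoint_inner_right, meanZeroVolterra_toL2_deriv]

/-- The second weak derivative inverts `-B B†`, where `B` is `meanZeroVolterra`. -/
theorem isWeakDeriv_two_meanZeroVolterra (hL : 0 < L) (g : L2 𝕜 L) :
    IsWeakDeriv 2 (meanZeroVolterra 𝕜 L ((meanZeroVolterra 𝕜 L).adjoint g)) (-g) := by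
  refine isWeakDeriv_two_iff.2 fun η h => ?_
  have hm := adjoint_meanZeroVolterra_mem g
  rw [meanZeroVolterra_apply_of_mem hm,
    isWeakDeriv_one_iff.1 (isWeakDeriv_one_volterra hL hm) _ h.deriv,
    inner_toL2_deriv_adjoint_meanZeroVolterra, inner_neg_right]

theorem meanZeroVolterra_mem_domain (hL : 0 < L) (g : L2 𝕜 L) :
    meanZeroVolterra 𝕜 L ((meanZeroVolterra 𝕜 L).adjoint g) ∈
      sobolevH 𝕜 L 2 ⊓ sobolevH0 𝕜 L 1 := by
  have hm := adjoint_meanZeroVolterra_mem g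
  refine ⟨mem_sobolevH_iff.2 fun j hj => ?_,
    (mem_sobolevH0_one_iff hL).2 ⟨_, hm, (meanZeroVolterra_apply_of_mem hm).symm⟩⟩
  interval_cases j
  · exact ⟨_, isWeakDeriv_zero_self _⟩
  · rw [meanZeroVolterra_apply_of_mem hm]
    exact ⟨_, isWeakDeriv_one_volterra hL hm⟩
  · exact ⟨_, isWeakDeriv_two_meanZeroVolterra hL g⟩

/-- Every `u ∈ H²(0, L) ∩ H₀¹(0, L)` is `-B B† u''`, where `B` is `meanZeroVolterra`. -/
theorem exists_meanZeroVolterra_eq (hL : 0 < L) {u : L2 𝕜 L}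
    (hu : u ∈ sobolevH 𝕜 L 2 ⊓ sobolevH0 𝕜 L 1) :
    ∃ g, meanZeroVolterra 𝕜 L ((meanZeroVolterra 𝕜 L).adjoint g) = u := by
  obtain ⟨v, hv, rfl⟩ := (mem_sobolevH0_one_iff hL).1 hu.2
  obtain ⟨g, hg⟩ := mem_sobolevH_iff.1 hu.1 2 le_rfl
  have hz : v - (meanZeroVolterra 𝕜 L).adjoint (-g) = 0 := by
    have hm : v - (meanZeroVolterra 𝕜 L).adjoint (-g) ∈ meanZero 𝕜 L :=
      sub_mem hv (adjoint_meanZeroVolterra_mem _)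
    refine (Submodule.disjoint_def.1 (𝕜 ∙ one 𝕜 L).orthogonal_disjoint) _ ?_ hm
    refine mem_span_one_of_isWeakDeriv_zero hL (isWeakDeriv_one_iff.2 fun η h => ?_)
    have h1 := isWeakDeriv_one_iff.1 (isWeakDeriv_one_volterra hL hv) _ h.deriv
    rw [isWeakDeriv_two_iff.1 hg η h] at h1
    rw [inner_sub_right, inner_toL2_deriv_adjoint_meanZeroVolterra h, inner_neg_right, h1,
      neg_neg, inner_zero_right, neg_zero]
    exact sub_self _
  refine ⟨-g, ?_⟩
  rw [← sub_eq_zero.1 hz, meanZeroVolterra_apply_of_mem hv]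

/-! ### The resolvent of the Sturm–Liouville operator -/

theorem operatorA_apply (hL : 0 < L) (c g : L2 𝕜 L) {u : (operatorA c).domain}
    (hu : meanZeroVolterra 𝕜 L ((meanZeroVolterra 𝕜 L).adjoint g) = u) :
    operatorA c u = -g + mulPrim c ((meanZeroVolterra 𝕜 L).adjoint g) := by
  have hm := adjoint_meanZeroVolterra_mem g
  refine congrArg₂ (· + ·) (weakDeriv_eq_of_isWeakDeriv
    ⟨(u : L2 𝕜 L), sobolevH_le_domain le_rfl u.2.1⟩ ?_) (Lp.ext ?_)
  · change IsWeakDeriv 2 (u : L2 𝕜 L) (-g)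
    rw [← hu]
    exact isWeakDeriv_two_meanZeroVolterra hL g
  · filter_upwards [(memLp_mul_of_mem_sobolevH0 c u.2.2).coeFn_toLp,
      coeFn_mulPrim c ((meanZeroVolterra 𝕜 L).adjoint g),
      coeFn_volterra ((meanZeroVolterra 𝕜 L).adjoint g)] with x h1 h2 h3
    rw [h1, h2, ← hu, meanZeroVolterra_apply_of_mem hm, h3]

theorem dense_domain_operatorA (hL : 0 < L) (c : L2 𝕜 L) :
    Dense ((operatorA c).domain : Set (L2 𝕜 L)) := by
  rw [Submodule.dense_iff_topologicalClosure_eq_top, Submodule.topologicalClosure_eq_top_iff,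
    Submodule.eq_bot_iff]
  intro f hf
  have h0 : (meanZeroVolterra 𝕜 L).adjoint f = 0 := by
    rw [← inner_self_eq_zero (𝕜 := 𝕜), ContinuousLinearMap.adjoint_inner_right]
    exact hf _ (meanZeroVolterra_mem_domain hL f)
  refine eq_zero_of_forall_inner_toL2_eq_zero fun η h => ?_
  rw [← inner_toL2_deriv_adjoint_meanZeroVolterra, h0, inner_zero_right]

/-- Through `u = B B† g`, where `B` is `meanZeroVolterra`, the operator `t - A` becomes the
bounded operator `1 + t B B† - c B†`, which is invertible for large `t`. -/
theorem exists_isResolventAt_operatorA (hL : 0 < L) (c : L2 𝕜 L) :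
    ∃ (z : 𝕜) (R : L2 𝕜 L →L[𝕜] L2 𝕜 L), (operatorA c).IsResolventAt z R ∧
      IsCompactOperator R := by
  set B := meanZeroVolterra 𝕜 L with hB
  obtain ⟨t, S, hS⟩ :=
    ContinuousLinearMap.exists_isUnit_one_add_smul_comp_adjoint_sub B (mulPrim c)
  have hSA (g : L2 𝕜 L) (u : (operatorA c).domain) (hu : B (B.adjoint g) = u) :
      (t : 𝕜) • (u : L2 𝕜 L) - operatorA c u = S.val g := by
    rw [operatorA_apply hL c g hu, hS, ← hu]
    simp only [sub_apply, add_apply, one_apply_eq_self, smul_apply,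
      ContinuousLinearMap.comp_apply, ← hB]
    abel
  have hr (g : L2 𝕜 L) : S.val (S⁻¹.val g) = g := congrArg (· g) S.mul_inv
  have hl (g : L2 𝕜 L) : S⁻¹.val (S.val g) = g := congrArg (· g) S.inv_mul
  refine ⟨t, B ∘L (B.adjoint ∘L S⁻¹.val), ⟨fun g => ?_, fun u => ?_⟩, ?_⟩
  · exact ⟨meanZeroVolterra_mem_domain hL _, (hSA (S⁻¹.val g) _ rfl).trans (hr g)⟩
  · obtain ⟨g, hg⟩ := exists_meanZeroVolterra_eq hL u.2
    rw [hSA g u hg]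
    exact (congrArg (fun f => B (B.adjoint f)) (hl g)).trans hg
  · exact (isCompactOperator_volterra.comp_clm _).comp_clm _

end SturmLiouville

theorem mainTheorem11 {𝕜 : Type*} [RCLike 𝕜] (L : ℝ) (hL : 0 < L) (c : SturmLiouville.L2 𝕜 L) :
    (SturmLiouville.operatorA c).HasCompactResolvent := by
  obtain ⟨z, R, hR, hc⟩ := SturmLiouville.exists_isResolventAt_operatorA hL c
  refine ⟨hR.isClosed, SturmLiouville.dense_domain_operatorA hL c, ⟨z, R, hR⟩, ?_⟩
  -- the resolvent chosen in the definition is `R`, by uniqueness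
  rw [(LinearPMap.unboundedResolvent_spec _ ⟨z, R, hR⟩).unique hR]
  exact hc
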